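/- For $k \ge 0$ let $Q_k(x_1,\dots,x_k,y_1,\dots,y_k)$ be the formal power series $$Q_k(x_1,\dots,x_k,y_1,\dots,y_k) = \sum_{(\lambda,\mu)} x_1^{\lambda_1}\cdots x_k^{\lambda_k}\, y_1^{\mu_1}\cdots y_k^{\mu_k},$$ where the sum is over all pairs of integer partitions $\mu \le \lambda$ (containment of Young diagrams, i.e. $\mu_j \le \lambda_j$ for all $j$, with $\mu$ padded by zeros) such that $\lambda$ has exactly $k$ nonzero parts $\lambda_1 \ge \dots \ge \lambda_k > 0$. The coefficients are taken in an arbitrary commutative ring (for instance $\mathbb{Z}$ or $\mathbb{Q}$). Write $Q_k = Q_k(x_1,\dots,x_k,y_1,\dots,y_k)$, $p_r = x_1\cdots x_r$ and $q_r = y_1 \cdots y_r$, with $p_0 = q_0 = 1$. Then $Q_0 = 1$, and for every $k > 0$ $$Q_k = \frac{x_k\, Q_{k-1}}{1-p_k} + \sum_{0 \le i < r \le k} \frac{p_k q_r}{(1-p_k)(1-p_r q_r)}\; Q_i \; Q_{k-r}\bigl(p_{r+1}q_r,\, x_{r+2},\dots,x_k,\, y_{r+1},\dots,y_k\bigr).$$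 Here, for $r<k$, the last factor is $Q_{k-r}$ with $p_{r+1}q_r, x_{r+2},\dots,x_k$ substituted for its $k-r$ $x$-variables and $y_{r+1},\dots,y_k$ for its $k-r$ $y$-variables; for $r = k$ it is $Q_0 = 1$. The identity holds in the ring of formal power series in the $x_i$ and $y_i$, where $1-p_k$ and $1-p_rq_r$ ($1 \le r \le k$) are invertible. -/

import Mathlib

namespace PartitionPairs

/-- The set of pairs `(lam, mu)` of partitions (Young diagrams) with `mu ≤ lam` in the Young
lattice such that `lam` has length exactly `k`, i.e. exactly `k` nonzero parts. The number of
nonempty rows of a diagram is the length of its first column. -/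
def pairs (k : ℕ) : Set (YoungDiagram × YoungDiagram) :=
  {P | P.2 ≤ P.1 ∧ P.1.colLen 0 = k}

/-- The exponent vector of the monomial `x ^ lam * y ^ mu` in the `2 k` variables
`x_1, …, x_k` (left summand) and `y_1, …, y_k` (right summand):
the exponent of `x_(j+1)` is the part `lam_(j+1)`, that of `y_(j+1)` is the part `mu_(j+1)`. -/
noncomputable def exponent (k : ℕ) (P : YoungDiagram × YoungDiagram) :
    Fin k ⊕ Fin k →₀ ℕ :=
  Finsupp.equivFunOnFinite.symm
    (Sum.elim (fun j : Fin k => P.1.rowLen j) (fun j : Fin k => P.2.rowLen j))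

/-- The generating function `Q_k` as a formal power series in `2 k` variables: the coefficient
of a monomial is the number of pairs `(lam, mu)` in `pairs k` with that monomial. -/
noncomputable def genQ (R : Type*) [CommRing R] (k : ℕ) : MvPowerSeries (Fin k ⊕ Fin k) R :=
  fun e => (Set.ncard {P | P ∈ pairs k ∧ exponent k P = e} : R)

/-- The ring of formal power series in `x_0, x_1, …` and `y_0, y_1, …`
(the variables `x_0`, `y_0` are never used). -/
abbrev Ambient (R : Type*) : Type _ := MvPowerSeries (ℕ ⊕ ℕ) R

section

variable (R : Type*) [CommRing R]

/-- The variable `x_i`. -/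
noncomputable def x (i : ℕ) : Ambient R := MvPowerSeries.X (Sum.inl i)

/-- The variable `y_i`. -/
noncomputable def y (i : ℕ) : Ambient R := MvPowerSeries.X (Sum.inr i)

/-- `p_r = x_1 ⋯ x_r`. -/
noncomputable def p (r : ℕ) : Ambient R := ∏ j ∈ Finset.Icc 1 r, x R j

/-- `q_r = y_1 ⋯ y_r`. -/
noncomputable def q (r : ℕ) : Ambient R := ∏ j ∈ Finset.Icc 1 r, y R j

variable {R} in
/-- `Q_k(a_1, …, a_k, b_1, …, b_k)`: substitution of `a` for the `x`-variables and of `b` for the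
`y`-variables in `Q_k`. -/
noncomputable def evalQ (k : ℕ) (a b : Fin k → Ambient R) : Ambient R :=
  MvPowerSeries.subst (Sum.elim a b) (genQ R k)

/-- `Q_k = Q_k(x_1, …, x_k, y_1, …, y_k)`. -/
noncomputable def Q (k : ℕ) : Ambient R :=
  evalQ k (fun j => x R (j + 1)) (fun j => y R (j + 1))

/-- `Q_(k-r)(p_(r+1) q_r, x_(r+2), …, x_k, y_(r+1), …, y_k)`, for `r ≤ k`. -/
noncomputable def shiftedQ (r k : ℕ) : Ambient R :=
  evalQ (k - r)
    (fun j => if (j : ℕ) = 0 then p R (r + 1) * q R r else x R (r + 1 + j))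
    (fun j => y R (r + 1 + j))

variable {R} in
/-- The fraction `a / d` of formal power series, for a denominator `d` with constant
coefficient `1`: here `MvPowerSeries.invOfUnit d 1` is the inverse of `d`. -/
noncomputable def frac (a d : Ambient R) : Ambient R := a * MvPowerSeries.invOfUnit d 1

/-- `R_(i,r,k) = p_k q_r / ((1 - p_k) (1 - p_r q_r)) * Q_i * Q_(k-r)(…)`. -/
noncomputable def term (i r k : ℕ) : Ambient R :=
  frac (p R k * q R r) ((1 - p R k) * (1 - p R r * q R r)) * Q R i * shiftedQ R r k

end

end PartitionPairs

/-! Multiplying by $1-p_k$ reduces the identity to a bijective decomposition of the pairs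
$\mu\le\lambda$ counted by $Q_k$. If $\lambda_k\ge 2$ and $\mu_j<\lambda_j$ for all $j\le k$, a
column of length $k$ can be taken off $\lambda$; these pairs contribute $p_kQ_k$ (`gf_removable`).
If $\lambda_k=1$ and $\mu_k=0$, the last row of $\lambda$ can be taken off; these contribute
$x_kQ_{k-1}$ (`gf_lastRowFree`). In every other pair some row $j\le k$ has $\mu_j=\lambda_j$
(`exists_lastTie`). Let $r$ be the last such row and $i<r$ the number of parts of $\lambda$
exceeding $\lambda_r$. Subtracting $\lambda_r$ from the first $r$ rows of both partitions leaves a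
pair counted by $Q_i$. Subtracting $1$ from the rows of $\lambda$ below $r$ leaves a pair counted by
$Q_{k-r}$, and the drop of $\lambda$ after row $r$ is a free integer $c\ge 0$, the source of
$1/(1-p_rq_r)$. The first part of the lower pair is also contained in the first $r$ rows of both
partitions, so its variable becomes $p_{r+1}q_r$. The bijection is `glueEquiv`, its effect on
monomials `weight_glueEquiv`. -/

namespace PartitionPairs

open MvPowerSeries

/-! ### Generating functions of weighted families. -/

/-- A finite type is counted by the fibres of a map into a finite set. -/
theorem natCard_eq_sum_fiber {α β : Type*} [Finite α] (f : α → β) (s : Finset β)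
    (h : ∀ a, f a ∈ s) : Nat.card α = ∑ b ∈ s, Nat.card {a // f a = b} := by
  classical
  have := Fintype.ofFinite α
  rw [Nat.card_eq_fintype_card, ← Finset.card_univ,
    Finset.card_eq_sum_card_fiberwise (f := f) (t := s) (fun a _ => h a)]
  refine Finset.sum_congr rfl fun b _ => ?_
  rw [Nat.card_eq_fintype_card, Fintype.card_subtype]

/-- Only finitely many objects have a given weight. -/
def FiniteFibers {ι σ : Type*} (w : ι → σ →₀ ℕ) : Prop :=
  ∀ e, Finite {i // w i = e}

/-- The generating function of a family of objects by their weights. -/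
noncomputable def gf (R : Type*) [CommRing R] {ι σ : Type*} (w : ι → σ →₀ ℕ) :
    MvPowerSeries σ R :=
  fun e => (Nat.card {i // w i = e} : R)

section

variable {R : Type*} [CommRing R] {ι κ σ τ : Type*}

theorem coeff_gf (w : ι → σ →₀ ℕ) (e : σ →₀ ℕ) :
    coeff e (gf R w) = (Nat.card {i // w i = e} : R) := rfl

theorem FiniteFibers.of_injective {w : ι → σ →₀ ℕ} (h : Function.Injective w) :
    FiniteFibers w := fun e =>
  have : Subsingleton {i // w i = e} :=
    ⟨fun a b => Subtype.ext (h (a.2.trans b.2.symm))⟩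
  inferInstance

theorem FiniteFibers.subtype {w : ι → σ →₀ ℕ} (h : FiniteFibers w) (P : ι → Prop) :
    FiniteFibers (fun i : {i // P i} => w i) := fun e => by
  have := h e
  exact Finite.of_injective (β := {i // w i = e}) (fun a => ⟨a.1.1, a.2⟩)
    fun a b hab => Subtype.ext (Subtype.ext (congrArg (fun z => z.1) hab))

/-- The fibres of a sum of weights, sorted by the first weight. -/
def sumFiberEquiv (w : ι → σ →₀ ℕ) (v : κ → σ →₀ ℕ) (e : σ →₀ ℕ)
    (b : (σ →₀ ℕ) × (σ →₀ ℕ)) (hb : b.1 + b.2 = e) :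
    {z : {z : ι × κ // w z.1 + v z.2 = e} // (w z.1.1, v z.1.2) = b} ≃
      {i // w i = b.1} × {j // v j = b.2} where
  toFun z := (⟨z.1.1.1, congrArg Prod.fst z.2⟩, ⟨z.1.1.2, congrArg Prod.snd z.2⟩)
  invFun z := ⟨⟨(z.1.1, z.2.1), by rw [z.1.2, z.2.2, hb]⟩, by simp [z.1.2, z.2.2]⟩
  left_inv _ := rfl
  right_inv _ := rfl

theorem FiniteFibers.add {w : ι → σ →₀ ℕ} {v : κ → σ →₀ ℕ} (hw : FiniteFibers w)
    (hv : FiniteFibers v) : FiniteFibers (fun z : ι × κ => w z.1 + v z.2) := fun e => by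
  classical
  have hf : ∀ z : {z : ι × κ // w z.1 + v z.2 = e},
      (w z.1.1, v z.1.2) ∈ Finset.HasAntidiagonal.antidiagonal e := fun z => by simpa using z.2
  let g : {z : ι × κ // w z.1 + v z.2 = e} →
      Σ b : Finset.HasAntidiagonal.antidiagonal e, {i // w i = b.1.1} × {j // v j = b.1.2} :=
    fun z => ⟨⟨_, hf z⟩, ⟨z.1.1, rfl⟩, ⟨z.1.2, rfl⟩⟩
  have : ∀ b : Finset.HasAntidiagonal.antidiagonal e, Finite ({i // w i = b.1.1} × {j // v j = b.1.2}) :=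
    fun b => @Finite.instProd _ _ (hw _) (hv _)
  refine Finite.of_injective g fun a b hab => ?_
  have h1 : (g a).2.1.1 = (g b).2.1.1 := by rw [hab]
  have h2 : (g a).2.2.1 = (g b).2.2.1 := by rw [hab]
  exact Subtype.ext (Prod.ext h1 h2)

/-- The pairs of total weight `e` are sorted by how `e` splits. Finite fibres matter because
`Nat.card` of an infinite type is `0`. -/
theorem gf_mul_gf {w : ι → σ →₀ ℕ} {v : κ → σ →₀ ℕ} (hw : FiniteFibers w)
    (hv : FiniteFibers v) :
    gf R w * gf R v = gf R (fun z : ι × κ => w z.1 + v z.2) := by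
  classical
  ext e
  have := hw.add hv e
  rw [coeff_mul, coeff_gf, natCard_eq_sum_fiber
    (fun z : {z : ι × κ // w z.1 + v z.2 = e} => (w z.1.1, v z.1.2)) (Finset.HasAntidiagonal.antidiagonal e)
    (fun z => by simpa using z.2), Nat.cast_sum]
  refine Finset.sum_congr rfl fun b hb => ?_
  rw [Nat.card_congr (sumFiberEquiv w v e b (by simpa using hb)), Nat.card_prod, Nat.cast_mul,
    coeff_gf, coeff_gf]

theorem gf_congr {w : ι → σ →₀ ℕ} {v : κ → σ →₀ ℕ} (f : ι ≃ κ) (h : ∀ i, v (f i) = w i) :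
    gf R w = gf R v := by
  ext e
  rw [coeff_gf, coeff_gf]
  exact congrArg _ (Nat.card_congr (f.subtypeEquiv fun i => by rw [h]))

theorem gf_eq_sum_fiber {w : ι → σ →₀ ℕ} (hw : FiniteFibers w) {β : Type*} (f : ι → β)
    (s : Finset β) (hf : ∀ i, f i ∈ s) :
    gf R w = ∑ b ∈ s, gf R (fun i : {i // f i = b} => w i) := by
  ext e
  have := hw e
  rw [map_sum, coeff_gf, natCard_eq_sum_fiber (fun i : {i // w i = e} => f i) s (fun i => hf i),
    Nat.cast_sum]
  refine Finset.sum_congr rfl fun b _ => ?_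
  rw [coeff_gf]
  exact congrArg _ (Nat.card_congr (Equiv.subtypeSubtypeEquivSubtypeInter _ _ |>.trans
    ((Equiv.subtypeEquivRight fun i => and_comm).trans
      (Equiv.subtypeSubtypeEquivSubtypeInter (fun i => f i = b) (fun i => w i = e)).symm)))

theorem gf_eq_add_compl {w : ι → σ →₀ ℕ} (hw : FiniteFibers w) (P : ι → Prop) :
    gf R w = gf R (fun i : {i // P i} => w i) + gf R (fun i : {i // ¬ P i} => w i) := by
  classical
  rw [gf_eq_sum_fiber hw (fun i => decide (P i)) Finset.univ (fun _ => Finset.mem_univ _),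
    Fintype.sum_bool]
  congr 1 <;> exact gf_congr (Equiv.subtypeEquivRight fun i => by simp) fun _ => rfl

theorem gf_unique [Unique ι] (w : ι → σ →₀ ℕ) : gf R w = monomial (w default) 1 := by
  classical
  ext e
  rw [coeff_gf, coeff_monomial]
  split_ifs with h
  · have : Unique {i // w i = e} := ⟨⟨default, h.symm⟩, fun a => Subtype.ext (Unique.eq_default _)⟩
    simp
  · have : IsEmpty {i // w i = e} :=
      ⟨fun a => h (by rw [← a.2, Unique.eq_default a.1])⟩
    simp

theorem monomial_mul_gf (m : σ →₀ ℕ) {w : ι → σ →₀ ℕ} (hw : FiniteFibers w) :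
    monomial m 1 * gf R w = gf R (fun i => m + w i) := by
  rw [← gf_unique (R := R) (fun _ : Unit => m), gf_mul_gf _ hw]
  · exact gf_congr (Equiv.punitProd ι) fun _ => rfl
  · exact .of_injective fun _ _ _ => rfl

theorem smul_injective {m : σ →₀ ℕ} (hm : m ≠ 0) :
    Function.Injective (fun n : ℕ => n • m) := by
  obtain ⟨s, hs⟩ := Finsupp.ne_iff.1 hm
  intro a b hab
  have := DFunLike.congr_fun hab s
  exact (mul_left_inj' hs).1 (by simpa using this)

/-- The geometric series of a monomial. -/
theorem one_sub_monomial_mul_gf {m : σ →₀ ℕ} (hm : m ≠ 0) :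
    (1 - monomial m 1) * gf R (fun n : ℕ => n • m) = 1 := by
  have hf := FiniteFibers.of_injective (smul_injective hm)
  have h0 : gf R (fun i : {n : ℕ // n = 0} => i.1 • m) = 1 := by
    rw [gf_unique]
    change monomial (0 • m) 1 = _
    simp
  -- The shift $n\mapsto n+1$ gives $G=1+mG$ for the geometric series $G$.
  have h1 : gf R (fun i : {n : ℕ // ¬ n = 0} => i.1 • m) =
      monomial m 1 * gf R (fun n : ℕ => n • m) := by
    rw [monomial_mul_gf _ hf]
    symm
    refine gf_congr ⟨fun n => ⟨n + 1, n.succ_ne_zero⟩, fun n => n.1 - 1, fun _ => rfl,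
      fun n => Subtype.ext (Nat.succ_pred_eq_of_ne_zero n.2)⟩ fun n => ?_
    simp [add_smul, add_comm]
  rw [sub_mul, one_mul, ← h1, sub_eq_iff_eq_add, ← h0]
  exact gf_eq_add_compl hf (fun n => n = 0)

/-- Substituting monomials transforms the weights linearly. -/
theorem subst_gf [Finite σ] {a : σ → MvPowerSeries τ R} (v : σ → τ →₀ ℕ)
    (ha : ∀ s, a s = monomial (v s) 1) (hv : ∀ s, v s ≠ 0) {w : ι → σ →₀ ℕ}
    (hw : FiniteFibers (fun i => (w i).sum fun s n => n • v s)) :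
    subst a (gf R w) = gf R (fun i => (w i).sum fun s n => n • v s) := by
  classical
  have hs : HasSubst a := hasSubst_of_constantCoeff_zero fun s => by
    rw [ha, ← coeff_zero_eq_constantCoeff_apply, coeff_monomial_ne (hv s).symm]
  have hprod : ∀ d : σ →₀ ℕ, (d.prod fun s n => a s ^ n) =
      monomial (d.sum fun s n => n • v s) (1 : R) := fun d => by
    simp only [Finsupp.prod, Finsupp.sum, ha, monomial_pow, one_pow, prod_monomial,
      Finset.prod_const_one]
  ext e
  have := hw e
  have := Fintype.ofFinite {i // ((w i).sum fun s n => n • v s) = e}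
  set F := {i // ((w i).sum fun s n => n • v s) = e}
  rw [coeff_subst hs, coeff_gf, natCard_eq_sum_fiber (fun i : F => w i)
    (Finset.univ.image fun i : F => w i)
    (fun i => Finset.mem_image_of_mem _ (Finset.mem_univ i)), Nat.cast_sum]
  -- Only exponent vectors that are weights of objects in the finite fibre over `e` contribute, so
  -- the sum over all `d` is finite.
  rw [finsum_eq_sum_of_support_subset]
  · refine Finset.sum_congr rfl fun d hd => ?_
    obtain ⟨i, -, rfl⟩ := Finset.mem_image.1 hd
    rw [hprod, i.2, coeff_monomial_same, smul_eq_mul, mul_one, coeff_gf]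
    refine congrArg _ (Nat.card_congr ⟨fun j => ⟨⟨j.1, ?_⟩, j.2⟩, fun j => ⟨j.1.1, j.2⟩,
      fun _ => rfl, fun _ => rfl⟩)
    rw [j.2]
    exact i.2
  · intro d hd
    rw [Function.mem_support, hprod, coeff_monomial, coeff_gf] at hd
    split_ifs at hd with h
    · have hne : Nat.card {i // w i = d} ≠ 0 := fun h0 => hd (by simp [h0])
      obtain ⟨⟨i, hi⟩⟩ := (Nat.card_ne_zero.1 hne).1
      refine Finset.mem_coe.2 (Finset.mem_image.2 ⟨⟨i, ?_⟩, Finset.mem_univ _, hi⟩)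
      rw [hi, h]
    · simp at hd

theorem frac_eq_mul {a d g : Ambient R} (hd : constantCoeff d = 1) (h : d * g = 1) :
    frac a d = a * g := by
  have h1 : invOfUnit d 1 * d = 1 := invOfUnit_mul d 1 (by simpa using hd)
  have h2 : invOfUnit d 1 = g := by
    rw [← mul_one (invOfUnit d 1), ← h, ← mul_assoc, h1, one_mul]
  rw [frac, h2]

end

/-- Allows classes to be given by a relation instead of a function; it is applied to the label
$(r,i)$ of the last tie. -/
theorem gf_eq_sum_of_existsUnique {R : Type*} [CommRing R] {ι σ β : Type*} {w : ι → σ →₀ ℕ}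
    (hw : FiniteFibers w) (P : β → ι → Prop) (s : Finset β)
    (hP : ∀ i, ∃ b ∈ s, P b i) (hu : ∀ i b b', P b i → P b' i → b = b') :
    gf R w = ∑ b ∈ s, gf R (fun i : {i // P b i} => w i) := by
  choose f hfs hf using hP
  rw [gf_eq_sum_fiber hw f s hfs]
  refine Finset.sum_congr rfl fun b _ => gf_congr (Equiv.subtypeEquivRight fun i => ?_) fun _ => rfl
  exact ⟨fun h => h ▸ hf i, fun h => hu i _ _ (hf i) h⟩

/-! ### Pairs of Young diagrams as pairs of sequences. -/

/-- The sequences `l`, `m` are the parts of partitions `lam`, `mu` with `mu ≤ lam`, where `lam` has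
exactly `k` nonzero parts. -/
structure IsPair (k : ℕ) (l m : ℕ → ℕ) : Prop where
  anti_left : ∀ i j, i ≤ j → l j ≤ l i
  anti_right : ∀ i j, i ≤ j → m j ≤ m i
  le : ∀ j, m j ≤ l j
  pos_iff : ∀ j, 0 < l j ↔ j < k

theorem IsPair.left_support {k : ℕ} {l m : ℕ → ℕ} (h : IsPair k l m) (j : ℕ) (hj : 0 < l j) :
    j < k :=
  (h.pos_iff j).1 hj

theorem IsPair.right_support {k : ℕ} {l m : ℕ → ℕ} (h : IsPair k l m) (j : ℕ) (hj : 0 < m j) :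
    j < k :=
  h.left_support j (hj.trans_le (h.le j))

/-- Pairs of partitions as pairs of sequences. -/
abbrev PairSeq (k : ℕ) : Type := {P : (ℕ → ℕ) × (ℕ → ℕ) // IsPair k P.1 P.2}

/-- The Young diagram with given row lengths. -/
def diagram (k : ℕ) (l : ℕ → ℕ) (hl : ∀ i j, i ≤ j → l j ≤ l i) : YoungDiagram where
  cells := (Finset.range k ×ˢ Finset.range (l 0)).filter fun c => c.2 < l c.1
  isLowerSet := by
    rintro ⟨a, b⟩ ⟨c, d⟩ hcd h
    have h1 : c ≤ a := hcd.1
    have h2 : d ≤ b := hcd.2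
    have := hl c a h1
    simp only [Finset.coe_filter, Finset.mem_product, Finset.mem_range, Set.mem_ofPred_eq] at h ⊢
    omega

theorem mem_diagram {k : ℕ} {l : ℕ → ℕ} (hl : ∀ i j, i ≤ j → l j ≤ l i)
    (hk : ∀ j, 0 < l j → j < k) (i j : ℕ) : (i, j) ∈ diagram k l hl ↔ j < l i := by
  have h1 := hl 0 i i.zero_le
  have h2 := hk i
  rw [← YoungDiagram.mem_cells]
  simp only [diagram, Finset.mem_filter, Finset.mem_product, Finset.mem_range]
  omega

theorem rowLen_diagram {k : ℕ} {l : ℕ → ℕ} (hl : ∀ i j, i ≤ j → l j ≤ l i)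
    (hk : ∀ j, 0 < l j → j < k) : (diagram k l hl).rowLen = l := by
  ext i
  refine eq_of_forall_lt_iff fun j => ?_
  rw [← YoungDiagram.mem_iff_lt_rowLen, mem_diagram hl hk]

theorem rowLen_injective : Function.Injective YoungDiagram.rowLen := fun a b h => by
  ext ⟨i, j⟩
  rw [YoungDiagram.mem_cells, YoungDiagram.mem_cells, YoungDiagram.mem_iff_lt_rowLen,
    YoungDiagram.mem_iff_lt_rowLen, h]

theorem isPair_rowLen {k : ℕ} {P : YoungDiagram × YoungDiagram} (hP : P ∈ pairs k) :
    IsPair k P.1.rowLen P.2.rowLen where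
  anti_left := P.1.rowLen_anti
  anti_right := P.2.rowLen_anti
  le j := le_of_forall_lt fun i hi => YoungDiagram.mem_iff_lt_rowLen.1
    (hP.1 (YoungDiagram.mem_iff_lt_rowLen.2 hi))
  pos_iff j := by
    rw [← YoungDiagram.mem_iff_lt_rowLen, YoungDiagram.mem_iff_lt_colLen, hP.2]

/-- A pair of Young diagrams is determined by its row lengths. -/
def pairsEquiv (k : ℕ) : pairs k ≃ PairSeq k where
  toFun P := ⟨(P.1.1.rowLen, P.1.2.rowLen), isPair_rowLen P.2⟩
  invFun P := ⟨(diagram k P.1.1 P.2.anti_left, diagram k P.1.2 P.2.anti_right), by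
    constructor
    · rintro ⟨i, j⟩ h
      exact (mem_diagram P.2.anti_left P.2.left_support i j).2
        (((mem_diagram P.2.anti_right P.2.right_support i j).1 h).trans_le (P.2.le i))
    · refine eq_of_forall_lt_iff fun i => ?_
      rw [← YoungDiagram.mem_iff_lt_colLen, mem_diagram _ P.2.left_support, P.2.pos_iff]⟩
  left_inv P := Subtype.ext (Prod.ext (rowLen_injective (rowLen_diagram P.1.1.rowLen_anti (isPair_rowLen P.2).left_support))
    (rowLen_injective (rowLen_diagram P.1.2.rowLen_anti (isPair_rowLen P.2).right_support)))
  right_inv P := Subtype.ext (Prod.ext (rowLen_diagram P.2.anti_left P.2.left_support)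
    (rowLen_diagram P.2.anti_right P.2.right_support))

/-- The exponent vector of a pair of sequences. -/
noncomputable def seqExponent (k : ℕ) (P : PairSeq k) : Fin k ⊕ Fin k →₀ ℕ :=
  Finsupp.equivFunOnFinite.symm (Sum.elim (fun j : Fin k => P.1.1 j) (fun j : Fin k => P.1.2 j))

/-! ### The series $Q_k$ and their specializations as generating functions. -/

section

variable {R : Type*} [CommRing R]

theorem genQ_eq_gf (k : ℕ) : genQ R k = gf R (seqExponent k) := by
  ext e
  rw [coeff_gf]
  change ((Set.ncard {P | P ∈ pairs k ∧ exponent k P = e} : ℕ) : R) = _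
  rw [← Nat.card_coe_set_eq]
  refine congrArg _ (Nat.card_congr ?_)
  refine (Equiv.subtypeSubtypeEquivSubtypeInter (· ∈ pairs k) (exponent k · = e)).symm.trans ?_
  exact (pairsEquiv k).subtypeEquiv fun P => Iff.rfl

/-- The weight of a pair when the variables have weights `a` and `b`. -/
noncomputable def pairWeight {τ : Type*} (k : ℕ) (a b : ℕ → τ →₀ ℕ) (P : PairSeq k) : τ →₀ ℕ :=
  ∑ j : Fin k, P.1.1 j • a j + ∑ j : Fin k, P.1.2 j • b j

/-- All substitutions in the recursion are by monomials, so they act on weights. Injectivity is a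
convenient source of finite fibres. -/
theorem evalQ_eq_gf {k : ℕ} {f g : Fin k → Ambient R} {a b : ℕ → ℕ ⊕ ℕ →₀ ℕ}
    (hf : ∀ j, f j = monomial (a j) 1) (hg : ∀ j, g j = monomial (b j) 1)
    (ha : ∀ j, a j ≠ 0) (hb : ∀ j, b j ≠ 0) (hi : Function.Injective (pairWeight k a b)) :
    evalQ k f g = gf R (pairWeight k a b) := by
  have hw : (fun P => (seqExponent k P).sum fun s n =>
      n • (Sum.elim (fun j : Fin k => a j) (fun j : Fin k => b j) s)) = pairWeight k a b := by
    funext P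
    rw [Finsupp.sum_fintype _ _ (by simp), Fintype.sum_sum_type]
    rfl
  rw [evalQ, genQ_eq_gf, subst_gf (Sum.elim (fun j : Fin k => a j) (fun j : Fin k => b j)), hw]
  · rintro (j | j)
    · exact hf j
    · exact hg j
  · rintro (j | j)
    · exact ha j
    · exact hb j
  · rw [hw]
    exact .of_injective hi

theorem sum_mul_eq_single {k : ℕ} {u f : ℕ → ℕ} (j : ℕ) (hu : k ≤ j → u j = 0)
    (hf : ∀ i, i ≠ j → f i = 0) : ∑ i : Fin k, u i * f i = u j * f j := by
  rw [Fin.sum_univ_eq_sum_range (fun i => u i * f i) k]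
  refine Finset.sum_eq_single j (fun i _ h => by rw [hf i h, mul_zero]) fun h => ?_
  rw [hu (by simpa using h), zero_mul]

theorem IsPair.left_eq_zero {k : ℕ} {l m : ℕ → ℕ} (h : IsPair k l m) {j : ℕ} (hj : k ≤ j) :
    l j = 0 := by
  have := h.pos_iff j
  omega

theorem IsPair.right_eq_zero {k : ℕ} {l m : ℕ → ℕ} (h : IsPair k l m) {j : ℕ} (hj : k ≤ j) :
    m j = 0 := by
  have := h.pos_iff j
  have := h.le j
  omega

/-- The exponent vector of `p_r`. -/
noncomputable def pExp (r : ℕ) : ℕ ⊕ ℕ →₀ ℕ := ∑ j ∈ Finset.Icc 1 r, Finsupp.single (Sum.inl j) 1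

/-- The exponent vector of `q_r`. -/
noncomputable def qExp (r : ℕ) : ℕ ⊕ ℕ →₀ ℕ := ∑ j ∈ Finset.Icc 1 r, Finsupp.single (Sum.inr j) 1

theorem p_eq_monomial (r : ℕ) : p R r = monomial (pExp r) 1 := by
  simp [p, pExp, x, X_def, prod_monomial]

theorem q_eq_monomial (r : ℕ) : q R r = monomial (qExp r) 1 := by
  simp [q, qExp, y, X_def, prod_monomial]

theorem pExp_inl (r n : ℕ) : pExp r (Sum.inl n) = if 1 ≤ n ∧ n ≤ r then 1 else 0 := by
  simp [pExp, Finsupp.finsetSum_apply, Finsupp.single_apply]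

theorem pExp_inr (r n : ℕ) : pExp r (Sum.inr n) = 0 := by
  simp [pExp, Finsupp.finsetSum_apply]

theorem qExp_inr (r n : ℕ) : qExp r (Sum.inr n) = if 1 ≤ n ∧ n ≤ r then 1 else 0 := by
  simp [qExp, Finsupp.finsetSum_apply, Finsupp.single_apply]

theorem qExp_inl (r n : ℕ) : qExp r (Sum.inl n) = 0 := by
  simp [qExp, Finsupp.finsetSum_apply]

theorem pExp_ne_zero {r : ℕ} (hr : 0 < r) : pExp r ≠ 0 := fun h => by
  have := DFunLike.congr_fun h (Sum.inl 1)
  rw [pExp_inl, if_pos ⟨le_rfl, hr⟩] at this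
  exact one_ne_zero this

/-- The weight of a pair in `Q_k`. -/
noncomputable def weight (k : ℕ) : PairSeq k → ℕ ⊕ ℕ →₀ ℕ :=
  pairWeight k (fun j => Finsupp.single (Sum.inl (j + 1)) 1)
    (fun j => Finsupp.single (Sum.inr (j + 1)) 1)

theorem weight_inl_zero {k : ℕ} (P : PairSeq k) : weight k P (Sum.inl 0) = 0 := by
  simp [weight, pairWeight]

theorem weight_inr_zero {k : ℕ} (P : PairSeq k) : weight k P (Sum.inr 0) = 0 := by
  simp [weight, pairWeight]

theorem weight_inl_succ {k : ℕ} (P : PairSeq k) (n : ℕ) :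
    weight k P (Sum.inl (n + 1)) = P.1.1 n := by
  simp only [weight, pairWeight, Finsupp.add_apply, Finsupp.finsetSum_apply, Finsupp.smul_apply,
    smul_eq_mul]
  rw [sum_mul_eq_single (u := P.1.1) (f := fun j => Finsupp.single (Sum.inl (j + 1)) 1
    (Sum.inl (n + 1))) n P.2.left_eq_zero fun i hi => by simp [hi]]
  simp

theorem weight_inr_succ {k : ℕ} (P : PairSeq k) (n : ℕ) :
    weight k P (Sum.inr (n + 1)) = P.1.2 n := by
  simp only [weight, pairWeight, Finsupp.add_apply, Finsupp.finsetSum_apply, Finsupp.smul_apply,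
    smul_eq_mul]
  rw [sum_mul_eq_single (u := P.1.2) (f := fun j => Finsupp.single (Sum.inr (j + 1)) 1
    (Sum.inr (n + 1))) n P.2.right_eq_zero fun i hi => by simp [hi]]
  simp

theorem weight_injective (k : ℕ) : Function.Injective (weight k) := fun P P' h => by
  refine Subtype.ext (Prod.ext (funext fun n => ?_) (funext fun n => ?_))
  · rw [← weight_inl_succ, h, weight_inl_succ]
  · rw [← weight_inr_succ, h, weight_inr_succ]

theorem Q_eq_gf (k : ℕ) : Q R k = gf R (weight k) :=
  evalQ_eq_gf (fun _ => rfl) (fun _ => rfl) (fun _ => by simp) (fun _ => by simp)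
    (weight_injective k)

/-- The weight of a pair in `Q_k(p_(r+1) q_r, x_(r+2), …, x_(r+k), y_(r+1), …, y_(r+k))`. -/
noncomputable def shiftedWeight (r k : ℕ) : PairSeq k → ℕ ⊕ ℕ →₀ ℕ :=
  pairWeight k
    (fun j => if j = 0 then pExp (r + 1) + qExp r else Finsupp.single (Sum.inl (r + 1 + j)) 1)
    (fun j => Finsupp.single (Sum.inr (r + 1 + j)) 1)

/-- Truncated subtraction makes `n - (r + 1)` zero for all `n ≤ r + 1`, so one formula covers the
block $p_{r+1}$ and the later single variables. -/
theorem shiftedWeight_inl (r : ℕ) {k : ℕ} (P : PairSeq k) (n : ℕ) :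
    shiftedWeight r k P (Sum.inl n) = if n = 0 then 0 else P.1.1 (n - (r + 1)) := by
  simp only [shiftedWeight, pairWeight, Finsupp.add_apply, Finsupp.finsetSum_apply,
    Finsupp.smul_apply, smul_eq_mul]
  rw [sum_mul_eq_single (u := P.1.1) (f := fun j => (if j = 0 then pExp (r + 1) + qExp r else
    Finsupp.single (Sum.inl (r + 1 + j)) 1 : ℕ ⊕ ℕ →₀ ℕ) (Sum.inl n)) (n - (r + 1))
    P.2.left_eq_zero fun i hi => ?_]
  · by_cases hn : n = 0
    · simp [hn, pExp_inl, qExp_inl]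
    · by_cases h : n ≤ r + 1
      · have h0 : n - (r + 1) = 0 := by omega
        have h1 : 1 ≤ n := by omega
        simp [h0, pExp_inl, qExp_inl, h, h1, hn]
      · have h0 : n - (r + 1) ≠ 0 := by omega
        have h1 : r + 1 + (n - (r + 1)) = n := by omega
        simp only [if_neg h0, h1, if_neg hn]
        simp
  · by_cases h0 : i = 0
    · have : ¬ (1 ≤ n ∧ n ≤ r + 1) := by omega
      simp only [if_pos h0, Finsupp.add_apply, pExp_inl, qExp_inl, if_neg this]
    · have : r + 1 + i ≠ n := by omega
      simp [h0, this]

theorem shiftedWeight_inr (r : ℕ) {k : ℕ} (P : PairSeq k) (n : ℕ) :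
    shiftedWeight r k P (Sum.inr n) =
      if n = 0 then 0 else if n ≤ r then P.1.1 0 else P.1.2 (n - (r + 1)) := by
  simp only [shiftedWeight, pairWeight, Finsupp.add_apply, Finsupp.finsetSum_apply,
    Finsupp.smul_apply, smul_eq_mul]
  rw [sum_mul_eq_single (u := P.1.1) (f := fun j => (if j = 0 then pExp (r + 1) + qExp r else
    Finsupp.single (Sum.inl (r + 1 + j)) 1 : ℕ ⊕ ℕ →₀ ℕ) (Sum.inr n)) 0
    P.2.left_eq_zero fun i hi => by simp [hi]]
  by_cases h : n ≤ r
  · rw [Finset.sum_eq_zero fun i _ => by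
      rw [Finsupp.single_eq_of_ne (by simp; omega), mul_zero]]
    by_cases hn : n = 0
    · simp [hn, pExp_inr, qExp_inr]
    · have : 1 ≤ n := by omega
      simp [pExp_inr, qExp_inr, h, hn, this]
  · rw [sum_mul_eq_single (u := P.1.2) (f := fun j => Finsupp.single (Sum.inr (r + 1 + j)) 1
      (Sum.inr n)) (n - (r + 1)) P.2.right_eq_zero fun i hi =>
        Finsupp.single_eq_of_ne (by simp; omega)]
    have h1 : r + 1 + (n - (r + 1)) = n := by omega
    have h2 : n ≠ 0 := by omega
    simp only [h1]
    simp [pExp_inr, qExp_inr, h, h2]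

/-- The exponents of $x_{r+1+n}$ and $y_{r+1+n}$ already recover both sequences. -/
theorem shiftedWeight_injective (r k : ℕ) : Function.Injective (shiftedWeight r k) :=
  fun P P' h => by
    refine Subtype.ext (Prod.ext (funext fun n => ?_) (funext fun n => ?_))
    · have := DFunLike.congr_fun h (Sum.inl (r + 1 + n))
      rw [shiftedWeight_inl, shiftedWeight_inl] at this
      simpa using this
    · have := DFunLike.congr_fun h (Sum.inr (r + 1 + n))
      rw [shiftedWeight_inr, shiftedWeight_inr] at this
      have h1 : ¬ r + 1 + n ≤ r := by omega
      simpa [h1] using this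

theorem shiftedQ_eq_gf (r k : ℕ) : shiftedQ R r k = gf R (shiftedWeight r (k - r)) := by
  refine evalQ_eq_gf (fun j => ?_) (fun _ => rfl) (fun j => ?_) (fun _ => by simp)
    (shiftedWeight_injective r _)
  · split_ifs
    · rw [p_eq_monomial, q_eq_monomial, monomial_mul_monomial, one_mul]
    · rfl
  · split_ifs
    · exact fun h => pExp_ne_zero r.succ_pos (add_eq_zero.1 h).1
    · simp

end

/-! ### The classes of pairs; removing a column or a row. -/

/-- A column of length `k` can be removed from the larger partition. -/
def Removable {k : ℕ} (P : PairSeq k) : Prop :=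
  2 ≤ P.1.1 (k - 1) ∧ ∀ j, j < k → P.1.2 j < P.1.1 j

/-- The last part of the larger partition is `1`, and that of the smaller one is `0`. -/
def LastRowFree {k : ℕ} (P : PairSeq k) : Prop :=
  P.1.1 (k - 1) = 1 ∧ P.1.2 (k - 1) = 0

/-- The last row where the two partitions agree has number `r`, and exactly `i` parts of the larger
partition exceed the part in that row. -/
structure LastTie {k : ℕ} (r i : ℕ) (P : PairSeq k) : Prop where
  pos : 0 < r
  le : r ≤ k
  tie : P.1.2 (r - 1) = P.1.1 (r - 1)
  lt_of_le : ∀ j, r ≤ j → j < k → P.1.2 j < P.1.1 j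
  lt : i < r
  lt_iff : ∀ n, n < i ↔ P.1.1 (r - 1) < P.1.1 n

theorem isPair_add_column {k : ℕ} {l m : ℕ → ℕ} (h : IsPair k l m) :
    IsPair k (fun j => if j < k then l j + 1 else 0) m where
  anti_left i j hij := by
    have := h.anti_left i j hij
    split_ifs <;> omega
  anti_right := h.anti_right
  le j := by
    have := h.le j
    have := h.pos_iff j
    split_ifs <;> omega
  pos_iff j := by
    split_ifs with hj <;> simp [hj]

/-- The bound `h2` keeps all `k` parts nonzero; the strict inequalities keep $\mu\le\lambda$. -/
theorem isPair_remove_column {k : ℕ} (hk : 0 < k) {l m : ℕ → ℕ} (h : IsPair k l m)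
    (h2 : 2 ≤ l (k - 1)) (hlt : ∀ j, j < k → m j < l j) : IsPair k (fun j => l j - 1) m where
  anti_left i j hij := Nat.sub_le_sub_right (h.anti_left i j hij) 1
  anti_right := h.anti_right
  le j := by
    have := h.le j
    have := h.pos_iff j
    have := hlt j
    omega
  pos_iff j := by
    have := h.pos_iff j
    have := h.anti_left j (k - 1)
    omega

/-- Adding a column of length `k` to the larger partition. -/
def columnEquiv {k : ℕ} (hk : 0 < k) : PairSeq k ≃ {P : PairSeq k // Removable P} where
  toFun P := ⟨⟨(fun j => if j < k then P.1.1 j + 1 else 0, P.1.2), isPair_add_column P.2⟩, by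
    constructor
    · have := P.2.pos_iff (k - 1)
      have h1 : k - 1 < k := by omega
      simp only [if_pos h1]
      omega
    · intro j hj
      have := P.2.le j
      simp only [if_pos hj]
      omega⟩
  invFun P := ⟨(fun j => P.1.1.1 j - 1, P.1.1.2), isPair_remove_column hk P.1.2 P.2.1 P.2.2⟩
  left_inv P := Subtype.ext (Prod.ext (funext fun j => by
    have := P.2.pos_iff j
    dsimp only
    split_ifs <;> omega) rfl)
  right_inv P := Subtype.ext (Subtype.ext (Prod.ext (funext fun j => by
    have := P.1.2.pos_iff j
    dsimp only
    split_ifs <;> omega) rfl))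

theorem not_removable_of_lastRowFree {k : ℕ} {P : PairSeq k} (h : LastRowFree P) :
    ¬ Removable P := fun h' => by
  have := h.1
  have := h'.1
  omega

theorem isPair_add_row {k : ℕ} (hk : 0 < k) {l m : ℕ → ℕ} (h : IsPair (k - 1) l m) :
    IsPair k (fun j => if j < k - 1 then l j else if j < k then 1 else 0) m where
  anti_left i j hij := by
    have := h.anti_left i j hij
    have := h.pos_iff i
    split_ifs <;> omega
  anti_right := h.anti_right
  le j := by
    have := h.le j
    have := h.pos_iff j
    split_ifs <;> omega
  pos_iff j := by
    have := h.pos_iff j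
    split_ifs <;> omega

theorem isPair_remove_row {k : ℕ} {l m : ℕ → ℕ} (h : IsPair k l m) (hm : m (k - 1) = 0) :
    IsPair (k - 1) (fun j => if j < k - 1 then l j else 0) m where
  anti_left i j hij := by
    have := h.anti_left i j hij
    split_ifs <;> omega
  anti_right := h.anti_right
  le j := by
    have := h.le j
    have := h.anti_right (k - 1) j
    split_ifs <;> omega
  pos_iff j := by
    have := h.pos_iff j
    split_ifs <;> omega

/-- Adding a row of length `1` to the larger partition. -/
def rowEquiv {k : ℕ} (hk : 0 < k) :
    PairSeq (k - 1) ≃ {P : {P : PairSeq k // ¬ Removable P} // LastRowFree P.1} where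
  toFun P :=
    have h : LastRowFree (k := k) ⟨(fun j => if j < k - 1 then P.1.1 j else if j < k then 1 else 0,
        P.1.2), isPair_add_row hk P.2⟩ := by
      constructor
      · have h1 : k - 1 < k := by omega
        simp [h1]
      · exact P.2.right_eq_zero le_rfl
    ⟨⟨_, not_removable_of_lastRowFree h⟩, h⟩
  invFun P := ⟨(fun j => if j < k - 1 then P.1.1.1.1 j else 0, P.1.1.1.2),
    isPair_remove_row P.1.1.2 P.2.2⟩
  left_inv P := Subtype.ext (Prod.ext (funext fun j => by
    have := P.2.pos_iff j
    dsimp only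
    split_ifs <;> omega) rfl)
  right_inv P := Subtype.ext (Subtype.ext (Subtype.ext (Prod.ext (funext fun j => by
    have h1 := P.1.1.2.pos_iff j
    have h2 := P.2.1
    dsimp only at h1 ⊢
    split_ifs with h3 h4
    · rfl
    · obtain rfl : j = k - 1 := by omega
      exact h2.symm
    · omega) rfl)))

/-! ### The last row where the partitions agree. -/

theorem exists_lastTie {k : ℕ} (hk : 0 < k) {P : PairSeq k} (h : ¬ Removable P)
    (h' : ¬ LastRowFree P) : ∃ r i, LastTie r i P := by
  classical
  obtain ⟨⟨l, m⟩, hP⟩ := P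
  -- Without a tie, non-removability forces $\lambda_k=1$, hence $\mu_k=0$, which is the excluded
  -- last-row case.
  have hex : ∃ j, j < k ∧ m j = l j := by
    by_contra hno
    push Not at hno
    have hlt : ∀ j, j < k → m j < l j := fun j hj => lt_of_le_of_ne (hP.le j) (hno j hj)
    have h1 := hP.pos_iff (k - 1)
    have h2 := hlt (k - 1) (by omega)
    by_cases h3 : 2 ≤ l (k - 1)
    · exact h ⟨h3, hlt⟩
    · refine h' ⟨?_, ?_⟩
      · change l (k - 1) = 1
        omega
      · change m (k - 1) = 0
        omega
  obtain ⟨j, hj, hjt⟩ := hex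
  -- Rows are numbered from `1` here while sequences start at `0`; `0 < r` excludes the truncated `0
  -- - 1`.
  let T : ℕ → Prop := fun r => 0 < r ∧ m (r - 1) = l (r - 1)
  have hT : T (j + 1) := ⟨j.succ_pos, hjt⟩
  have hr := Nat.findGreatest_spec (P := T) (n := k) hj hT
  have hrk : Nat.findGreatest T k ≤ k := Nat.findGreatest_le k
  have hmax : ∀ n, Nat.findGreatest T k < n → n ≤ k → ¬ T n :=
    fun n hn hnk => Nat.findGreatest_is_greatest hn hnk
  generalize Nat.findGreatest T k = r at hr hrk hmax
  -- Since `l` decreases, the least such index is the number of parts exceeding $\lambda_r$.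
  have hfind : ∃ n, l n ≤ l (r - 1) := ⟨r - 1, le_rfl⟩
  have h4 := hr.1
  refine ⟨r, Nat.find hfind, h4, hrk, hr.2, fun n hn hnk => ?_, ?_, fun n => ?_⟩
  · refine lt_of_le_of_ne (hP.le n) fun he => hmax (n + 1) (by omega) hnk ⟨n.succ_pos, he⟩
  · exact (Nat.find_min' hfind le_rfl).trans_lt (by omega)
  · constructor
    · exact fun hn => not_le.1 (Nat.find_min hfind hn)
    · intro hn
      by_contra hle
      have h5 := hP.anti_left _ _ (not_lt.1 hle)
      have h6 := Nat.find_spec hfind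
      exact absurd hn (not_lt.2 (h5.trans h6))

theorem LastTie.unique {k : ℕ} {P : PairSeq k} {r i r' i' : ℕ} (h : LastTie r i P)
    (h' : LastTie r' i' P) : r = r' ∧ i = i' := by
  have hr : r = r' := by
    rcases lt_trichotomy r r' with hlt | he | hlt
    · have := h.lt_of_le (r' - 1) (by omega) (by have := h'.le; omega)
      have := h'.tie
      omega
    · exact he
    · have := h'.lt_of_le (r - 1) (by omega) (by have := h.le; omega)
      have := h.tie
      omega
  subst hr
  have h1 := h.lt_iff i
  have h2 := h'.lt_iff i
  have h3 := h.lt_iff i'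
  have h4 := h'.lt_iff i'
  omega

theorem LastTie.not_removable {k : ℕ} {P : PairSeq k} {r i : ℕ} (h : LastTie r i P) :
    ¬ Removable P := fun h' => by
  have h1 := h.pos
  have := h'.2 (r - 1) (by have := h.le; omega)
  have := h.tie
  omega

/-! ### Cutting and gluing at the last tie. -/

section Glue

variable {i r k : ℕ}

/-- The larger partition glued from the part `u` above row `r` and the part `a` below. -/
def glueLeft (r k c : ℕ) (u a : ℕ → ℕ) (j : ℕ) : ℕ :=
  if j < r then u j + a 0 + 1 + c else if j < k then a (j - r) + 1 else 0

/-- The smaller partition glued from the part `v` above row `r` and the part `b` below. -/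
def glueRight (r c : ℕ) (v a b : ℕ → ℕ) (j : ℕ) : ℕ :=
  if j < r then v j + a 0 + 1 + c else b (j - r)

/-- The first `r` rows are raised by `a 0 + 1 + c`, at least the largest row below, so both glued
sequences stay decreasing. -/
theorem isPair_glue {u v a b : ℕ → ℕ} (hu : IsPair i u v) (ha : IsPair (k - r) a b) (c : ℕ)
    (hrk : r ≤ k) : IsPair k (glueLeft r k c u a) (glueRight r c v a b) where
  anti_left n j hnj := by
    have := hu.anti_left n j hnj
    have := ha.anti_left (n - r) (j - r) (by omega)
    have := ha.anti_left 0 (j - r) (by omega)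
    unfold glueLeft
    split_ifs <;> omega
  anti_right n j hnj := by
    have := hu.anti_right n j hnj
    have := ha.anti_right (n - r) (j - r) (by omega)
    have := ha.anti_left 0 (j - r) (by omega)
    have := ha.le (j - r)
    unfold glueRight
    split_ifs <;> omega
  le j := by
    have := hu.le j
    have := ha.le (j - r)
    have := ha.pos_iff (j - r)
    unfold glueLeft glueRight
    split_ifs <;> omega
  pos_iff j := by
    unfold glueLeft
    split_ifs <;> omega

/-- As `i < r`, both `u` and `v` vanish at index `r - 1`, which makes the tie; below it, `b ≤ a < a
+ 1` forbids another. -/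
theorem lastTie_glue {u v a b : ℕ → ℕ} (hu : IsPair i u v) (ha : IsPair (k - r) a b) (c : ℕ)
    (hrk : r ≤ k) (hir : i < r) :
    LastTie r i (k := k) ⟨(glueLeft r k c u a, glueRight r c v a b),
      isPair_glue hu ha c hrk⟩ := by
  have h0 : u (r - 1) = 0 := hu.left_eq_zero (by omega)
  have h1 : v (r - 1) = 0 := hu.right_eq_zero (by omega)
  have h2 : r - 1 < r := by omega
  have h3 : 0 < r := by omega
  refine ⟨h3, hrk, ?_, fun j hj hjk => ?_, hir, fun n => ?_⟩
  · simp [glueLeft, glueRight, h0, h1, h2]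
  · have := ha.le (j - r)
    simp only [glueLeft, glueRight, if_neg (not_lt.2 hj), if_pos hjk]
    omega
  · have := hu.pos_iff n
    have := ha.anti_left 0 (n - r) (by omega)
    simp only [glueLeft, if_pos h2, h0]
    split_ifs <;> omega

theorem not_lastRowFree_glue {u v a b : ℕ → ℕ} (hu : IsPair i u v) (ha : IsPair (k - r) a b)
    (c : ℕ) (hrk : r ≤ k) :
    ¬ LastRowFree (k := k) ⟨(glueLeft r k c u a, glueRight r c v a b),
      isPair_glue hu ha c hrk⟩ := by
  rintro ⟨h1, h2⟩
  have := ha.pos_iff (k - 1 - r)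
  simp only [glueLeft, glueRight] at h1 h2
  split_ifs at h1 h2 <;> omega

/-- Truncated subtraction sends every row from the tie on to `0`, so no explicit cut-off is needed.
-/
theorem isPair_above {l m : ℕ → ℕ} (h : IsPair k l m) (hi : ∀ n, n < i ↔ l (r - 1) < l n) :
    IsPair i (fun j => l j - l (r - 1)) (fun j => m j - l (r - 1)) where
  anti_left n j hnj := Nat.sub_le_sub_right (h.anti_left n j hnj) _
  anti_right n j hnj := Nat.sub_le_sub_right (h.anti_right n j hnj) _
  le j := Nat.sub_le_sub_right (h.le j) _
  pos_iff j := by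
    rw [hi]
    exact Nat.sub_pos_iff_lt

/-- For `r < k`, strictness in the last row together with `hf` gives $\lambda_k\ge 2$, so
subtracting `1` loses no part. -/
theorem isPair_below {l m : ℕ → ℕ} (h : IsPair k l m) (hlt : ∀ j, r ≤ j → j < k → m j < l j)
    (hf : ¬ (l (k - 1) = 1 ∧ m (k - 1) = 0)) :
    IsPair (k - r) (fun j => l (r + j) - 1) (fun j => m (r + j)) where
  anti_left n j hnj := Nat.sub_le_sub_right (h.anti_left _ _ (by omega)) _
  anti_right n j hnj := h.anti_right _ _ (by omega)
  le j := by
    have := hlt (r + j) (by omega)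
    have := h.pos_iff (r + j)
    have := h.le (r + j)
    omega
  pos_iff j := by
    have := hlt (k - 1)
    have := h.pos_iff (r + j)
    have := h.anti_left (r + j) (k - 1)
    omega

/-- The pairs with last tie in row `r` are cut below this row into independent pieces. -/
def glueEquiv (hrk : r ≤ k) (hir : i < r) :
    ℕ × (PairSeq i × PairSeq (k - r)) ≃
      {P : {P : {P : PairSeq k // ¬ Removable P} // ¬ LastRowFree P.1} //
        LastTie r i P.1.1} where
  toFun z := ⟨⟨⟨⟨(glueLeft r k z.1 z.2.1.1.1 z.2.2.1.1,
      glueRight r z.1 z.2.1.1.2 z.2.2.1.1 z.2.2.1.2), isPair_glue z.2.1.2 z.2.2.2 z.1 hrk⟩,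
      (lastTie_glue z.2.1.2 z.2.2.2 z.1 hrk hir).not_removable⟩,
      not_lastRowFree_glue z.2.1.2 z.2.2.2 z.1 hrk⟩,
      lastTie_glue z.2.1.2 z.2.2.2 z.1 hrk hir⟩
  -- This is $\lambda_r-\lambda_{r+1}$ if `r < k`, and $\lambda_k-1$ if `r = k`, where
  -- $\lambda_{k+1}=0$ and truncation gives `0 - 1 = 0`.
  invFun P := (P.1.1.1.1.1 (r - 1) - 1 - (P.1.1.1.1.1 r - 1),
    ⟨(fun j => P.1.1.1.1.1 j - P.1.1.1.1.1 (r - 1), fun j => P.1.1.1.1.2 j - P.1.1.1.1.1 (r - 1)),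
      isPair_above P.1.1.1.2 P.2.lt_iff⟩,
    ⟨(fun j => P.1.1.1.1.1 (r + j) - 1, fun j => P.1.1.1.1.2 (r + j)),
      isPair_below P.1.1.1.2 P.2.lt_of_le P.1.2⟩)
  left_inv z := by
    obtain ⟨c, ⟨⟨u, v⟩, hu⟩, ⟨⟨a, b⟩, ha⟩⟩ := z
    dsimp only at hu ha
    have h0 : u (r - 1) = 0 := hu.left_eq_zero (by omega)
    have h2 : r - 1 < r := by omega
    have h3 : k ≤ r → a 0 = 0 := fun h => ha.left_eq_zero (by omega)
    refine Prod.ext ?_ (Prod.ext (Subtype.ext (Prod.ext (funext fun j => ?_) (funext fun j => ?_)))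
      (Subtype.ext (Prod.ext (funext fun j => ?_) (funext fun j => ?_))))
    · simp only [glueLeft, if_pos h2, h0, lt_irrefl, if_false, Nat.sub_self]
      split_ifs <;> omega
    · have := hu.pos_iff j
      have := ha.anti_left 0 (j - r) (by omega)
      simp only [glueLeft, if_pos h2, h0]
      split_ifs <;> omega
    · have := hu.pos_iff j
      have := hu.le j
      have := ha.anti_left 0 (j - r) (by omega)
      have := ha.le (j - r)
      simp only [glueLeft, glueRight, if_pos h2, h0]
      split_ifs <;> omega
    · have := ha.pos_iff j
      have h4 : ¬ r + j < r := by omega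
      simp only [glueLeft, if_neg h4, Nat.add_sub_cancel_left]
      split_ifs <;> omega
    · have h4 : ¬ r + j < r := by omega
      simp only [glueRight, if_neg h4, Nat.add_sub_cancel_left]
  right_inv P := by
    obtain ⟨⟨⟨⟨⟨l, m⟩, hP⟩, h1⟩, h2⟩, h3⟩ := P
    have hpos := hP.pos_iff (r - 1)
    have ht := h3.tie
    dsimp only at hP ht hpos
    have har := hP.anti_left (r - 1) r (by omega)
    refine Subtype.ext (Subtype.ext (Subtype.ext (Subtype.ext (Prod.ext (funext fun j => ?_)
      (funext fun j => ?_)))))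
    · have := hP.pos_iff j
      have := hP.anti_left j (r - 1)
      simp only [glueLeft, Nat.add_zero]
      split_ifs with h4 h5
      · omega
      · rw [show r + (j - r) = j by omega]
        omega
      · omega
    · have := hP.anti_right j (r - 1)
      simp only [glueRight, Nat.add_zero]
      split_ifs with h4
      · omega
      · rw [show r + (j - r) = j by omega]

/-- The added units give $p_kq_r$ and the summands `c` give $(p_rq_r)^c$; the copies of `a 0` in the
first `r` rows of both partitions are accounted for by the variable $p_{r+1}q_r$. -/
theorem weight_glueEquiv (hrk : r ≤ k) (hir : i < r) (z : ℕ × (PairSeq i × PairSeq (k - r))) :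
    weight k (glueEquiv hrk hir z).1.1.1 =
      pExp k + qExp r + (z.1 • (pExp r + qExp r) + (weight i z.2.1 + shiftedWeight r (k - r) z.2.2)) := by
  obtain ⟨c, P, S⟩ := z
  ext (n | n)
  · simp only [Finsupp.add_apply, Finsupp.smul_apply, pExp_inl, qExp_inl, shiftedWeight_inl,
      smul_eq_mul, add_zero]
    rcases n with _ | n
    · simp [weight_inl_zero]
    · rw [weight_inl_succ, weight_inl_succ]
      change glueLeft r k c P.1.1 S.1.1 n = _
      have h0 : r ≤ n → P.1.1 n = 0 := fun h => P.2.left_eq_zero (by omega)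
      have h1 : k ≤ n → S.1.1 (n - r) = 0 := fun h => S.2.left_eq_zero (by omega)
      have h2 : n + 1 - (r + 1) = n - r := by omega
      have h3 : n < r → n - r = 0 := by omega
      rw [h2, glueLeft]
      by_cases hn : n < r
      · have h4 : n < k := by omega
        have h5 : n + 1 ≤ k := h4
        have h6 : n + 1 ≤ r := hn
        simp [hn, h5, h6, h3 hn]
        omega
      · have h6 : ¬ n + 1 ≤ r := hn
        have h7 := h0 (by omega)
        by_cases h4 : n < k
        · have h5 : n + 1 ≤ k := h4
          simp [hn, h4, h5, h6, h7]
          omega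
        · have h5 : ¬ n + 1 ≤ k := h4
          have h8 := h1 (by omega)
          simp [hn, h4, h5, h6, h7, h8]
  · simp only [Finsupp.add_apply, Finsupp.smul_apply, pExp_inr, qExp_inr, shiftedWeight_inr,
      smul_eq_mul, zero_add]
    rcases n with _ | n
    · simp [weight_inr_zero]
    · rw [weight_inr_succ, weight_inr_succ]
      change glueRight r c P.1.2 S.1.1 S.1.2 n = _
      have h0 : r ≤ n → P.1.2 n = 0 := fun h => P.2.right_eq_zero (by omega)
      have h2 : n + 1 - (r + 1) = n - r := by omega
      rw [h2, glueRight]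
      by_cases hn : n < r
      · have h6 : n + 1 ≤ r := hn
        simp [hn, h6]
        omega
      · have h6 : ¬ n + 1 ≤ r := hn
        simp [hn, h6, h0 (by omega)]

end Glue

/-! ### Assembling the recursion. -/

section

variable {R : Type*} [CommRing R]

theorem Q_zero : Q R 0 = 1 := by
  have : Unique (PairSeq 0) :=
    { default := ⟨(fun _ => 0, fun _ => 0), by constructor <;> simp⟩
      uniq := fun P => Subtype.ext (Prod.ext (funext fun j => P.2.left_eq_zero j.zero_le)
        (funext fun j => P.2.right_eq_zero j.zero_le)) }
  rw [Q_eq_gf, gf_unique, show weight 0 default = 0 by simp [weight, pairWeight]]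
  simp

theorem gf_removable {k : ℕ} (hk : 0 < k) :
    gf R (fun P : {P : PairSeq k // Removable P} => weight k P) = p R k * Q R k := by
  rw [Q_eq_gf, p_eq_monomial, monomial_mul_gf _ (.of_injective (weight_injective k))]
  symm
  refine gf_congr (columnEquiv hk) fun P => ?_
  ext (n | n) <;> rcases n with _ | n <;>
    simp only [Finsupp.add_apply, pExp_inl, pExp_inr, weight_inl_zero, weight_inr_zero,
      weight_inl_succ, weight_inr_succ]
  · simp
  · change (if n < k then P.1.1 n + 1 else 0) = _
    have := P.2.pos_iff n
    split_ifs <;> omega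
  · exact (zero_add _).symm

theorem gf_lastRowFree {k : ℕ} (hk : 0 < k) :
    gf R (fun P : {P : {P : PairSeq k // ¬ Removable P} // LastRowFree P.1} => weight k P.1) =
      x R k * Q R (k - 1) := by
  rw [Q_eq_gf, x, X_def, monomial_mul_gf _ (.of_injective (weight_injective _))]
  symm
  refine gf_congr (rowEquiv hk) fun P => ?_
  ext (n | n) <;> rcases n with _ | n <;>
    simp only [Finsupp.add_apply, weight_inl_zero, weight_inr_zero,
      weight_inl_succ, weight_inr_succ, Finsupp.single_apply, Sum.inl.injEq, reduceCtorEq, if_false]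
  · simp [hk.ne']
  · change (if n < k - 1 then P.1.1 n else if n < k then 1 else 0) = _
    have := P.2.pos_iff n
    split_ifs <;> omega
  · exact (zero_add _).symm

theorem gf_lastTie {i r k : ℕ} (hrk : r ≤ k) (hir : i < r) :
    gf R (fun P : {P : {P : {P : PairSeq k // ¬ Removable P} // ¬ LastRowFree P.1} //
        LastTie r i P.1.1} => weight k P.1.1) =
      p R k * q R r * (gf R (fun n : ℕ => n • (pExp r + qExp r)) *
        (Q R i * shiftedQ R r k)) := by
  have hne : pExp r + qExp r ≠ 0 := fun h =>
    pExp_ne_zero (i.zero_le.trans_lt hir) (add_eq_zero.1 h).1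
  have h1 := FiniteFibers.of_injective (weight_injective i)
  have h2 := FiniteFibers.of_injective (shiftedWeight_injective r (k - r))
  have h3 := FiniteFibers.of_injective (smul_injective hne)
  rw [p_eq_monomial, q_eq_monomial, monomial_mul_monomial, one_mul, Q_eq_gf, shiftedQ_eq_gf,
    gf_mul_gf h1 h2, gf_mul_gf h3 (h1.add h2), monomial_mul_gf _ (h3.add (h1.add h2))]
  exact (gf_congr (glueEquiv hrk hir) fun z => weight_glueEquiv hrk hir z).symm

/-- The removable pairs reproduce $p_kQ_k$, which moves to the left; the right side counts the
remaining classes. -/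
theorem one_sub_p_mul_Q {k : ℕ} (hk : 0 < k) :
    (1 - p R k) * Q R k = x R k * Q R (k - 1) +
      ∑ r ∈ Finset.Icc 1 k, ∑ i ∈ Finset.range r,
        p R k * q R r * (gf R (fun n : ℕ => n • (pExp r + qExp r)) *
          (Q R i * shiftedQ R r k)) := by
  have hw := FiniteFibers.of_injective (weight_injective k)
  have hw' := hw.subtype fun P => ¬ Removable P
  have hw'' := hw'.subtype fun P => ¬ LastRowFree P.1
  have hQ : Q R k = p R k * Q R k +
      gf R (fun P : {P : PairSeq k // ¬ Removable P} => weight k P) := by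
    rw [← gf_removable hk, ← gf_eq_add_compl hw, Q_eq_gf]
  rw [sub_mul, one_mul, sub_eq_iff_eq_add']
  refine hQ.trans (congrArg _ ?_)
  rw [gf_eq_add_compl hw' (fun P => LastRowFree P.1), gf_lastRowFree hk]
  congr 1
  rw [gf_eq_sum_of_existsUnique hw''
    (fun (b : (_ : ℕ) × ℕ) P => LastTie b.1 b.2 P.1.1)
    ((Finset.Icc 1 k).sigma fun r => Finset.range r), Finset.sum_sigma]
  · refine Finset.sum_congr rfl fun r hr => Finset.sum_congr rfl fun i hi => ?_
    exact gf_lastTie (Finset.mem_Icc.1 hr).2 (Finset.mem_range.1 hi)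
  · intro P
    obtain ⟨r, i, h⟩ := exists_lastTie hk P.1.2 P.2
    exact ⟨⟨r, i⟩, by simpa using ⟨⟨h.pos, h.le⟩, h.lt⟩, h⟩
  · rintro P ⟨r, i⟩ ⟨r', i'⟩ h h'
    obtain ⟨rfl, rfl⟩ := LastTie.unique h h'
    rfl

theorem frac_one_sub_monomial (a : Ambient R) {m : ℕ ⊕ ℕ →₀ ℕ} (hm : m ≠ 0) :
    frac a (1 - monomial m 1) = a * gf R (fun n : ℕ => n • m) := by
  refine frac_eq_mul ?_ (one_sub_monomial_mul_gf hm)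
  rw [map_sub, map_one, ← coeff_zero_eq_constantCoeff_apply, coeff_monomial_ne hm.symm, sub_zero]

theorem frac_one_sub_mul_one_sub (a : Ambient R) {m n : ℕ ⊕ ℕ →₀ ℕ} (hm : m ≠ 0) (hn : n ≠ 0) :
    frac a ((1 - monomial m 1) * (1 - monomial n 1)) =
      a * (gf R (fun c : ℕ => c • m) * gf R (fun c : ℕ => c • n)) := by
  refine frac_eq_mul ?_ ?_
  · rw [map_mul, map_sub, map_sub, map_one, ← coeff_zero_eq_constantCoeff_apply,
      ← coeff_zero_eq_constantCoeff_apply, coeff_monomial_ne hm.symm, coeff_monomial_ne hn.symm,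
      sub_zero, one_mul]
  · rw [mul_mul_mul_comm, one_sub_monomial_mul_gf hm, one_sub_monomial_mul_gf hn, one_mul]

theorem Q_recursion {k : ℕ} (hk : 0 < k) :
    Q R k = frac (x R k * Q R (k - 1)) (1 - p R k) +
      ∑ r ∈ Finset.Icc 1 k, ∑ i ∈ Finset.range r, term R i r k := by
  have hp := pExp_ne_zero hk
  have hg : gf R (fun n : ℕ => n • pExp k) * (1 - p R k) = 1 := by
    rw [mul_comm, p_eq_monomial, one_sub_monomial_mul_gf hp]
  -- Division by $1-p_k$ is multiplication by its geometric series.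
  have h : Q R k = gf R (fun n : ℕ => n • pExp k) * ((1 - p R k) * Q R k) := by
    rw [← mul_assoc, hg, one_mul]
  rw [h, one_sub_p_mul_Q hk, mul_add, p_eq_monomial,
    frac_one_sub_monomial _ hp, mul_comm]
  congr 1
  rw [Finset.mul_sum]
  refine Finset.sum_congr rfl fun r hr => ?_
  rw [Finset.mul_sum]
  refine Finset.sum_congr rfl fun i _ => ?_
  have hpq : pExp r + qExp r ≠ 0 := fun h =>
    pExp_ne_zero (Finset.mem_Icc.1 hr).1 (add_eq_zero.1 h).1
  rw [term, p_eq_monomial, p_eq_monomial, q_eq_monomial,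
    monomial_mul_monomial (pExp r) (qExp r), one_mul, frac_one_sub_mul_one_sub _ hp hpq]
  ring

end

end PartitionPairs

theorem mainTheorem1 (R : Type*) [CommRing R] :
    PartitionPairs.Q R 0 = 1 ∧
      ∀ k : ℕ, 0 < k →
        PartitionPairs.Q R k =
          PartitionPairs.frac (PartitionPairs.x R k * PartitionPairs.Q R (k - 1))
              (1 - PartitionPairs.p R k) +
            ∑ r ∈ Finset.Icc 1 k, ∑ i ∈ Finset.range r, PartitionPairs.term R i r k :=
  ⟨PartitionPairs.Q_zero, fun _ hk => PartitionPairs.Q_recursion hk⟩
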